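/- Let $N\ge 1$, let $M(N)$ be the space of complex $N\times N$ matrices, and let $T:M(N)\to M(N)$ be a positive linear operator, i.e. $T$ is linear over $\mathbb C$ and $T(X)\succeq 0$ whenever $X\succeq 0$. Let $T^{*}$ be the dual of $T$ with respect to the inner product $\langle X,Y\rangle=\mathrm{tr}(XY^{\dagger})$, and put $$DS(T)=\mathrm{tr}\big((T(I)-I)^{2}\big)+\mathrm{tr}\big((T^{*}(I)-I)^{2}\big).$$ A positive operator $S$ is called *$\epsilon$-doubly stochastic* if $DS(S)\le\epsilon^{2}$, and *rank non-decreasing* if $\mathrm{Rank}(S(X))\ge \mathrm{Rank}(X)$ for all $X\succeq 0$. For $C_1,C_2\in M(N)$ the *operator scaling* $S_{C_1,C_2}(T)$ of $T$ is the positive operator $X\mapsto C_1\,T(C_2^{\dagger}XC_2)\,C_1^{\dagger}$. If $T(I)$ and $T^{*}(I)$ are nonsingular, put $R(T)=S_{T(I)^{-1/2},\,I}(T)$ and $C(T)=S_{I,\,T^{*}(I)^{-1/2}}(T)$. The *operator Sinkhorn iteration* started at $T$ is the sequence $T_0=T$, $T_{n+1}=R(T_n)$ for even $n$, $T_{n+1}=C(T_n)$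 for odd $n$. 1. If $T(I)$ and $T^{*}(I)$ are nonsingular, then $T_n(I)$ and $T_n^{*}(I)$ are nonsingular for every $n$, so that the iteration is defined for all $n$, and $DS(T_n)\to 0$ if and only if $T$ is rank non-decreasing. Moreover, if $T$ is rank non-decreasing, then $T(I)$ and $T^{*}(I)$ are nonsingular. 2. $T$ is rank non-decreasing if and only if for every $\epsilon>0$ there are $C_1,C_2\in M(N)$ such that the operator scaling $S_{C_1,C_2}(T)$ is $\epsilon$-doubly stochastic. -/

import Mathlib

open scoped ComplexOrder MatrixOrder

noncomputable section

namespace OpScaling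

/-- The complex vector space of `N × N` complex matrices. -/
abbrev M (N : ℕ) : Type := Matrix (Fin N) (Fin N) ℂ

/-- A linear operator on matrices is positive if it maps positive semidefinite
matrices to positive semidefinite matrices. -/
def IsPositive {N : ℕ} (T : M N →ₗ[ℂ] M N) : Prop :=
  ∀ X : M N, X.PosSemidef → (T X).PosSemidef

/-- `Rank (T X) ≥ Rank X` for all positive semidefinite `X`. -/
def RankNonDecreasing {N : ℕ} (T : M N →ₗ[ℂ] M N) : Prop :=
  ∀ X : M N, X.PosSemidef → X.rank ≤ (T X).rank

/-- The dual `T*` of `T` with respect to the inner product `⟨X, Y⟩ = tr (X Yᴴ)`, written in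
entries: `T*(Y) i j` is the conjugate of `tr (T(E i j) Yᴴ)`. The lemmas `trace_dual` and
`eq_dual` below show that it is the map determined by `⟨T X, Y⟩ = ⟨X, T* Y⟩`. -/
def dual {N : ℕ} (T : M N →ₗ[ℂ] M N) : M N →ₗ[ℂ] M N where
  toFun Y := Matrix.of fun i j => star ((T (Matrix.single i j 1) * Y.conjTranspose).trace)
  map_add' Y Z := by
    ext i j
    simp [Matrix.mul_add]
  map_smul' c Y := by
    ext i j
    simp

theorem trace_dual {N : ℕ} (T : M N →ₗ[ℂ] M N) (X Y : M N) :
    (T X * Y.conjTranspose).trace = (X * (dual T Y).conjTranspose).trace := by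
  have hX : T X = ∑ i, ∑ j, X i j • T (Matrix.single i j 1) := by
    conv_lhs => rw [Matrix.matrix_eq_sum_single X]
    simp only [map_sum]
    refine Finset.sum_congr rfl fun i _ => Finset.sum_congr rfl fun j _ => ?_
    rw [← map_smul, Matrix.smul_single, smul_eq_mul, mul_one]
  rw [hX]
  simp only [Finset.sum_mul, Matrix.trace_sum, Matrix.smul_mul, Matrix.trace_smul]
  simp [Matrix.trace, Matrix.mul_apply, dual, Matrix.diag]

theorem eq_dual {N : ℕ} (T : M N →ₗ[ℂ] M N) (S : M N → M N)
    (h : ∀ X Y : M N, (T X * Y.conjTranspose).trace = (X * (S Y).conjTranspose).trace)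
    (Y : M N) : S Y = dual T Y := by
  ext i j
  have := h (Matrix.single i j 1) Y
  rw [Matrix.trace_single_mul, one_smul] at this
  simp [dual, this]

/-- `DS(T) = tr ((T(I) - I)²) + tr ((T*(I) - I)²)`. For positive `T` both matrices are Hermitian,
so that the two traces are real numbers; `re` only changes the type from `ℂ` to `ℝ`. -/
def DS {N : ℕ} (T : M N →ₗ[ℂ] M N) : ℝ :=
  (((T 1 - 1) ^ 2).trace + ((dual T 1 - 1) ^ 2).trace).re

/-- `ε`-doubly stochastic operators. -/
def IsEpsDoublyStochastic {N : ℕ} (ε : ℝ) (T : M N →ₗ[ℂ] M N) : Prop :=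
  IsPositive T ∧ DS T ≤ ε ^ 2

/-- The operator scaling `S_{C₁,C₂}(T)(X) = C₁ T(C₂ᴴ X C₂) C₁ᴴ`. -/
def scaling {N : ℕ} (C₁ C₂ : M N) (T : M N →ₗ[ℂ] M N) : M N →ₗ[ℂ] M N where
  toFun X := C₁ * T (C₂.conjTranspose * X * C₂) * C₁.conjTranspose
  map_add' X Y := by simp [Matrix.mul_add, Matrix.add_mul]
  map_smul' c X := by simp

/-- `A^{-1/2}` for a positive definite matrix `A`: the inverse of the positive square root. -/
def invSqrt {N : ℕ} (A : M N) : M N := (CFC.sqrt A)⁻¹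

/-- Row scaling `R(T) = S_{T(I)^{-1/2}, I}(T)`, meaningful if `T(I)` is nonsingular. -/
def rowScaling {N : ℕ} (T : M N →ₗ[ℂ] M N) : M N →ₗ[ℂ] M N :=
  scaling (invSqrt (T 1)) 1 T

/-- Column scaling `C(T) = S_{I, T*(I)^{-1/2}}(T)`, meaningful if `T*(I)` is nonsingular. -/
def colScaling {N : ℕ} (T : M N →ₗ[ℂ] M N) : M N →ₗ[ℂ] M N :=
  scaling 1 (invSqrt (dual T 1)) T

/-- The hypothesis under which the row and column scalings of `T` are defined. -/
def Scalable {N : ℕ} (T : M N →ₗ[ℂ] M N) : Prop :=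
  IsUnit (T 1) ∧ IsUnit (dual T 1)

/-- The trajectory `T, R(T), CR(T), RCR(T), …` of operator Sinkhorn's iterative scaling. -/
def osi {N : ℕ} (T : M N →ₗ[ℂ] M N) : ℕ → (M N →ₗ[ℂ] M N)
  | 0 => T
  | n + 1 => if Even n then rowScaling (osi T n) else colScaling (osi T n)

end OpScaling

end

/-!
The driving quantity is the ratio `det (T X) / det X` over positive semidefinite `X`.

If `T` is rank non-decreasing, this ratio is bounded below by a positive constant
(`exists_det_lower_bound`). Write `X = U diag(d) Uᴴ`, fix an index `i` and let `E` be the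
orthogonal projection onto the span of the eigenvectors with eigenvalue at least `d i`. Then
`X ≥ d i • E`, so `T X ≥ d i • T E`, and `T E` has rank at least `rank E`. As the unitary group is
compact, a single `ε > 0` works for all `U`: on some subspace of dimension at least `rank E` the
quadratic form of `T E` is at least `ε ‖v‖²` (`exists_uniform_pos`). Therefore `T X` has at least as
many eigenvalues `≥ ε * d i` as `X` has eigenvalues `≥ d i`. By Hall's theorem the eigenvalues
of `X` can be matched injectively to eigenvalues of `T X` that are at least `ε` times as large, and
`det (T X) ≥ ε ^ N * det X`.

One step of the Sinkhorn iteration divides the best lower bound by the determinant of the marginal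
that it normalizes, `det (T I)` or `det (T* I)` (`det_bound_osi`). From the first step on that
marginal has trace `N`, since the other one is the identity, so its determinant is at most `1` by
the inequality of arithmetic and geometric means. The bounds therefore increase; they stay at most
`1`, because `det (T_n I) ≤ 1`. Hence the determinants tend to `1`, and
`tr ((A - 1)²) ≤ (2 N + 2) * (- log det A)` for positive definite `A` of trace `N`
(`trace_sub_one_sq_le`) turns this into `DS (T_n) → 0`.

Conversely, `DS S < 1 / (2 N + 1)` forces `S` to be rank non-decreasing
(`rankNonDecreasing_of_DS_lt`): if `P` and `Q` are the projections onto the ranges of `X` and `S X`,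
then `tr (P S*(I)) = tr (S P) ≤ tr (S(I) Q)`, which is impossible for almost doubly stochastic `S`
if `rank P > rank Q`. A scaling of `T` is rank non-decreasing only if `T` is
(`RankNonDecreasing.of_scaling`), and each `T_n` is a scaling of `T`.
-/

open scoped ComplexOrder MatrixOrder

namespace OpScaling

open Matrix Filter Topology

variable {n : Type*} [Fintype n]

section

variable [DecidableEq n]

/-! ### Spectral decompositions -/

/-- The matrix `U diag(d) Uᴴ` with real `d`. It is used with unitary `U` only, so that the columns
of `U` are orthonormal eigenvectors, with eigenvalues `d`. -/
def conjDiag (U : Matrix n n ℂ) (d : n → ℝ) : Matrix n n ℂ :=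
  U * diagonal (fun i => (d i : ℂ)) * Uᴴ

theorem posSemidef_conjDiag (U : Matrix n n ℂ) {d : n → ℝ} (hd : ∀ i, 0 ≤ d i) :
    (conjDiag U d).PosSemidef := by
  refine PosSemidef.mul_mul_conjTranspose_same (PosSemidef.diagonal fun i => ?_) U
  simpa using hd i

theorem conjDiag_sub (U : Matrix n n ℂ) (d e : n → ℝ) :
    conjDiag U (fun i => d i - e i) = conjDiag U d - conjDiag U e := by
  simp only [conjDiag]
  rw [← sub_mul, ← mul_sub, diagonal_sub]
  simp

theorem conjDiag_smul (U : Matrix n n ℂ) (c : ℝ) (d : n → ℝ) :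
    conjDiag U (fun i => c * d i) = (c : ℂ) • conjDiag U d := by
  simp only [conjDiag]
  rw [← Matrix.smul_mul, ← Matrix.mul_smul, ← diagonal_smul]
  congr 3
  ext i
  simp

theorem conjDiag_one {U : Matrix n n ℂ} (hU : U ∈ unitaryGroup n ℂ) :
    conjDiag U (fun _ => 1) = 1 := by
  have h : U * Uᴴ = 1 := mem_unitaryGroup_iff.1 hU
  simpa [conjDiag] using h

theorem conjDiag_mul {U : Matrix n n ℂ} (hU : U ∈ unitaryGroup n ℂ) (d e : n → ℝ) :
    conjDiag U d * conjDiag U e = conjDiag U (fun i => d i * e i) := by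
  have h : Uᴴ * U = 1 := mem_unitaryGroup_iff'.1 hU
  calc _ = U * diagonal (fun i => (d i : ℂ)) * (Uᴴ * U) * diagonal (fun i => (e i : ℂ)) * Uᴴ := by
        simp only [conjDiag, Matrix.mul_assoc]
    _ = _ := by
        rw [h, Matrix.mul_one, Matrix.mul_assoc U, diagonal_mul_diagonal]
        simp [conjDiag]

theorem trace_conjDiag {U : Matrix n n ℂ} (hU : U ∈ unitaryGroup n ℂ) (d : n → ℝ) :
    (conjDiag U d).trace = ((∑ i, d i : ℝ) : ℂ) := by
  have h : Uᴴ * U = 1 := mem_unitaryGroup_iff'.1 hU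
  rw [conjDiag, trace_mul_comm, ← Matrix.mul_assoc, h, Matrix.one_mul, trace_diagonal]
  simp

theorem norm_det_conjDiag {U : Matrix n n ℂ} (hU : U ∈ unitaryGroup n ℂ) {d : n → ℝ}
    (hd : ∀ i, 0 ≤ d i) : ‖(conjDiag U d).det‖ = ∏ i, d i := by
  have h : Uᴴ * U = 1 := mem_unitaryGroup_iff'.1 hU
  rw [conjDiag, det_mul_comm, ← Matrix.mul_assoc, h, Matrix.one_mul, det_diagonal, norm_prod]
  exact Finset.prod_congr rfl fun i _ => by simp [abs_of_nonneg (hd i)]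

theorem rank_conjDiag {U : Matrix n n ℂ} (hU : U ∈ unitaryGroup n ℂ) (d : n → ℝ) :
    (conjDiag U d).rank = (Finset.univ.filter fun i => d i ≠ 0).card := by
  have h : Uᴴ * U = 1 := mem_unitaryGroup_iff'.1 hU
  have h1 : IsUnit U.det := isUnit_det_of_left_inverse h
  have h2 : IsUnit Uᴴ.det := isUnit_det_of_right_inverse h
  rw [conjDiag, rank_mul_eq_left_of_isUnit_det _ _ h2, rank_mul_eq_right_of_isUnit_det _ _ h1,
    rank_diagonal, Fintype.card_subtype]
  simp

theorem exists_eq_conjDiag_of_posSemidef {A : Matrix n n ℂ} (hA : A.PosSemidef) :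
    ∃ U ∈ unitaryGroup n ℂ, ∃ d : n → ℝ, (∀ i, 0 ≤ d i) ∧ A = conjDiag U d :=
  ⟨hA.1.eigenvectorUnitary, hA.1.eigenvectorUnitary.2, hA.1.eigenvalues, hA.eigenvalues_nonneg, by
    conv_lhs => rw [hA.1.spectral_theorem]
    rfl⟩

theorem exists_eq_conjDiag_of_posDef {A : Matrix n n ℂ} (hA : A.PosDef) :
    ∃ U ∈ unitaryGroup n ℂ, ∃ d : n → ℝ, (∀ i, 0 < d i) ∧ A = conjDiag U d :=
  ⟨hA.1.eigenvectorUnitary, hA.1.eigenvectorUnitary.2, hA.1.eigenvalues, hA.eigenvalues_pos, by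
    conv_lhs => rw [hA.1.spectral_theorem]
    rfl⟩

theorem dotProduct_conjDiag_mulVec (U : Matrix n n ℂ) (d : n → ℝ) (v : n → ℂ) :
    star v ⬝ᵥ (conjDiag U d *ᵥ v) = ((∑ k, d k * ‖(Uᴴ *ᵥ v) k‖ ^ 2 : ℝ) : ℂ) := by
  have h : star v ⬝ᵥ (conjDiag U d *ᵥ v) =
      star (Uᴴ *ᵥ v) ⬝ᵥ (diagonal (fun i => (d i : ℂ)) *ᵥ (Uᴴ *ᵥ v)) := by
    rw [star_mulVec, conjTranspose_conjTranspose, ← dotProduct_mulVec]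
    simp only [conjDiag, mulVec_mulVec, Matrix.mul_assoc]
  rw [h, dotProduct]
  push_cast
  refine Finset.sum_congr rfl fun k _ => ?_
  rw [mulVec_diagonal, ← Complex.conj_mul', Pi.star_apply, Complex.star_def]
  ring

theorem dotProduct_self_eq_sum {U : Matrix n n ℂ} (hU : U ∈ unitaryGroup n ℂ) (v : n → ℂ) :
    star v ⬝ᵥ v = ((∑ k, ‖(Uᴴ *ᵥ v) k‖ ^ 2 : ℝ) : ℂ) := by
  have := dotProduct_conjDiag_mulVec U (fun _ => 1) v
  rw [conjDiag_one hU, one_mulVec] at this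
  simpa using this

theorem trace_mul_nonneg {A B : Matrix n n ℂ} (hA : A.PosSemidef) (hB : B.PosSemidef) :
    0 ≤ (A * B).trace := by
  obtain ⟨C, rfl⟩ := CStarAlgebra.nonneg_iff_eq_star_mul_self.1 hB.nonneg
  rw [← Matrix.mul_assoc, trace_mul_comm, ← Matrix.mul_assoc]
  exact (hA.mul_mul_conjTranspose_same C).trace_nonneg

/-- The half of the min-max principle that is needed: if a Hermitian matrix is bounded below by `c`
on a subspace `V`, then it has at least `dim V` eigenvalues `≥ c`. The coordinates with respect to
the eigenvectors with eigenvalue `≥ c` already determine a vector of `V`. -/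
theorem finrank_le_card_le_eigenvalues {U : Matrix n n ℂ} (hU : U ∈ unitaryGroup n ℂ) (d : n → ℝ)
    (c : ℝ) (V : Submodule ℂ (n → ℂ))
    (hV : ∀ v ∈ V, c * (star v ⬝ᵥ v).re ≤ (star v ⬝ᵥ (conjDiag U d *ᵥ v)).re) :
    Module.finrank ℂ V ≤ (Finset.univ.filter fun k => c ≤ d k).card := by
  let f : V →ₗ[ℂ] ({k // c ≤ d k} → ℂ) :=
    (LinearMap.funLeft ℂ ℂ Subtype.val) ∘ₗ Uᴴ.mulVecLin ∘ₗ V.subtype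
  have hf : Function.Injective f := by
    rw [injective_iff_map_eq_zero]
    rintro ⟨v, hv⟩ h
    have h0 : ∀ k, c ≤ d k → (Uᴴ *ᵥ v) k = 0 := fun k hk => congrFun h ⟨k, hk⟩
    have h1 := hV v hv
    rw [dotProduct_conjDiag_mulVec, dotProduct_self_eq_sum hU, Complex.ofReal_re,
      Complex.ofReal_re, Finset.mul_sum] at h1
    have h2 : ∀ k, (Uᴴ *ᵥ v) k = 0 := by
      by_contra! hne
      obtain ⟨k, hk⟩ := hne
      have hck : d k < c := by
        by_contra! hc
        exact hk (h0 k hc)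
      refine absurd h1 (not_le.2 ?_)
      refine Finset.sum_lt_sum (fun i _ => ?_) ⟨k, Finset.mem_univ k, ?_⟩
      · by_cases hi : c ≤ d i
        · simp [h0 i hi]
        · gcongr
          exact (not_le.1 hi).le
      · have : 0 < ‖(Uᴴ *ᵥ v) k‖ := norm_pos_iff.2 hk
        gcongr
    have h3 : star v ⬝ᵥ v = 0 := by
      rw [dotProduct_self_eq_sum hU]
      simp [h2]
    exact Subtype.ext (dotProduct_star_self_eq_zero.1 h3)
  have := LinearMap.finrank_le_finrank_of_injective hf
  rwa [Module.finrank_fintype_fun_eq_card, Fintype.card_subtype] at this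

/-- The positive values of a finite family are bounded away from `0`. -/
theorem exists_pos_le_of_pos {n : Type*} [Finite n] (d : n → ℝ) :
    ∃ ε : ℝ, 0 < ε ∧ ∀ k, 0 < d k → ε ≤ d k := by
  have : ∀ᶠ ε in nhdsWithin (0 : ℝ) (Set.Ioi 0), ∀ k, 0 < d k → ε ≤ d k := by
    rw [Filter.eventually_all]
    intro k
    by_cases hk : 0 < d k
    · filter_upwards [Ioo_mem_nhdsGT hk] with ε hε _
      exact hε.2.le
    · simp [hk]
  obtain ⟨ε, h1, h2⟩ := (this.and self_mem_nhdsWithin).exists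
  exact ⟨ε, h2, h1⟩

/-- A positive semidefinite matrix is bounded below on a subspace of dimension its rank, namely on
the span of the eigenvectors with nonzero eigenvalue. -/
theorem exists_submodule_rank_le_of_posSemidef {A : Matrix n n ℂ} (hA : A.PosSemidef) :
    ∃ ε : ℝ, 0 < ε ∧ ∃ V : Submodule ℂ (n → ℂ), A.rank ≤ Module.finrank ℂ V ∧
      ∀ v ∈ V, ε * (star v ⬝ᵥ v).re ≤ (star v ⬝ᵥ (A *ᵥ v)).re := by
  obtain ⟨U, hU, d, hd, rfl⟩ := exists_eq_conjDiag_of_posSemidef hA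
  obtain ⟨ε, hε, hεd⟩ := exists_pos_le_of_pos d
  let f : (n → ℂ) →ₗ[ℂ] ({k // d k = 0} → ℂ) :=
    (LinearMap.funLeft ℂ ℂ Subtype.val) ∘ₗ Uᴴ.mulVecLin
  refine ⟨ε, hε, LinearMap.ker f, ?_, fun v hv => ?_⟩
  · have h1 := LinearMap.finrank_range_add_finrank_ker f
    have h2 := Submodule.finrank_le (LinearMap.range f)
    rw [Module.finrank_fintype_fun_eq_card] at h1 h2
    rw [Fintype.card_subtype] at h2
    rw [rank_conjDiag hU]
    have h3 := Finset.card_filter_add_card_filter_not (s := (Finset.univ : Finset n))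
      (fun k => d k = 0)
    rw [Finset.card_univ] at h3
    simp only [ne_eq]
    omega
  · have h0 : ∀ k, d k = 0 → (Uᴴ *ᵥ v) k = 0 := fun k hk => congrFun hv ⟨k, hk⟩
    rw [dotProduct_conjDiag_mulVec, dotProduct_self_eq_sum hU, Complex.ofReal_re,
      Complex.ofReal_re, Finset.mul_sum]
    refine Finset.sum_le_sum fun k _ => ?_
    by_cases hk : d k = 0
    · simp [h0 k hk]
    · exact mul_le_mul_of_nonneg_right (hεd k ((hd k).lt_of_ne' hk)) (by positivity)

/-- A quantitative form of the inequality of arithmetic and geometric means for the eigenvalues of a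
positive definite matrix whose trace is the dimension. -/
theorem trace_sub_one_sq_le {A : Matrix n n ℂ} (hA : A.PosDef) (htr : A.trace = Fintype.card n) :
    ((A - 1) ^ 2).trace.re ≤ (2 * Fintype.card n + 2) * (-Real.log ‖A.det‖) := by
  obtain ⟨U, hU, d, hd, rfl⟩ := exists_eq_conjDiag_of_posDef hA
  rw [norm_det_conjDiag hU fun i => (hd i).le, Real.log_prod fun i _ => (hd i).ne',
    ← conjDiag_one hU, ← conjDiag_sub, sq, conjDiag_mul hU, trace_conjDiag hU, Complex.ofReal_re]
  rw [trace_conjDiag hU] at htr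
  have hs : ∑ i, d i = Fintype.card n := by exact_mod_cast htr
  have hle : ∀ i, d i ≤ Fintype.card n := fun i =>
    hs ▸ Finset.single_le_sum (fun j _ => (hd j).le) (Finset.mem_univ i)
  have hz : ∑ i, (d i - 1) = 0 := by simp [hs]
  have key : ∀ i, (d i - 1) * (d i - 1) ≤
      (2 * Fintype.card n + 2) * ((d i - 1) - Real.log (d i)) := by
    intro i
    have hp := Real.sqrt_pos.2 (hd i)
    have hsq := Real.sq_sqrt (hd i).le
    set s := Real.sqrt (d i)
    -- `log x = 2 log √x ≤ 2 (√x - 1)` gives `(√x - 1) ^ 2 ≤ x - 1 - log x`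
    have h1 : Real.log (d i) ≤ 2 * (s - 1) := by
      rw [← hsq, Real.log_pow]
      have := Real.log_le_sub_one_of_pos hp
      push_cast
      linarith
    have h2 := hle i
    rw [← hsq] at h1 h2 ⊢
    have h3 : (s - 1) ^ 2 ≤ s ^ 2 - 1 - Real.log (s ^ 2) := by nlinarith
    have h4 : (s + 1) ^ 2 ≤ 2 * Fintype.card n + 2 := by nlinarith [sq_nonneg (s - 1)]
    calc (s ^ 2 - 1) * (s ^ 2 - 1) = (s + 1) ^ 2 * (s - 1) ^ 2 := by ring
      _ ≤ _ := by gcongr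
  calc _ ≤ ∑ i, (2 * (Fintype.card n : ℝ) + 2) * ((d i - 1) - Real.log (d i)) :=
        Finset.sum_le_sum fun i _ => key i
    _ = _ := by rw [← Finset.mul_sum, Finset.sum_sub_distrib, hz, zero_sub]

theorem trace_sq_nonneg {A : Matrix n n ℂ} (hA : A.IsHermitian) : 0 ≤ (A ^ 2).trace.re := by
  have := (posSemidef_conjTranspose_mul_self A).trace_nonneg
  rw [hA.eq, ← sq] at this
  exact (Complex.le_def.1 this).1

/-- The inequality `0 ≤ tr ((A - t Q)²)`, used in place of Cauchy-Schwarz. -/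
theorem two_mul_trace_mul_le {A Q : Matrix n n ℂ} (hA : A.IsHermitian) (hQ : Q.IsHermitian) (t : ℝ) :
    2 * t * (A * Q).trace.re ≤ (A ^ 2).trace.re + t ^ 2 * (Q ^ 2).trace.re := by
  have h : (A - (t : ℂ) • Q).IsHermitian := by
    refine hA.sub ?_
    rw [IsHermitian, conjTranspose_smul, hQ.eq]
    simp
  have := trace_sq_nonneg h
  rw [sq, sub_mul, mul_sub, mul_sub, trace_sub, trace_sub, trace_sub] at this
  simp only [Matrix.smul_mul, Matrix.mul_smul, trace_smul, smul_eq_mul, trace_mul_comm Q A,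
    Complex.sub_re, Complex.re_ofReal_mul] at this
  rw [sq A, sq Q]
  linarith

/-! ### The determinant under rank non-decreasing operators -/

variable {N : ℕ} {T : M N →ₗ[ℂ] M N}

section

open scoped Matrix.Norms.L2Operator

theorem neg_norm_mul_le_dotProduct_mulVec {B : Matrix n n ℂ} (hB : B.IsHermitian) (v : n → ℂ) :
    -‖B‖ * (star v ⬝ᵥ v).re ≤ (star v ⬝ᵥ (B *ᵥ v)).re := by
  have h : (B - -algebraMap ℝ (Matrix n n ℂ) ‖B‖).PosSemidef :=
    Matrix.le_iff.1 (IsSelfAdjoint.neg_algebraMap_norm_le_self (a := B) hB)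
  have h2 := h.re_dotProduct_nonneg v
  rw [sub_neg_eq_add, add_mulVec, dotProduct_add, Algebra.algebraMap_eq_smul_one, smul_mulVec,
    one_mulVec, dotProduct_smul, map_add] at h2
  simp only [RCLike.re_to_complex, Complex.smul_re, smul_eq_mul] at h2
  linarith

theorem isCompact_unitaryGroup : IsCompact (unitaryGroup n ℂ : Set (Matrix n n ℂ)) := by
  have : ProperSpace (Matrix n n ℂ) := FiniteDimensional.proper ℂ _
  refine Metric.isCompact_of_isClosed_isBounded isClosed_unitary ?_
  rcases subsingleton_or_nontrivial (Matrix n n ℂ) with h | h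
  · exact (Set.subsingleton_of_subsingleton (s := _)).finite.isBounded
  · refine (Metric.isBounded_closedBall (x := (0 : Matrix n n ℂ)) (r := 1)).subset fun U hU => ?_
    simpa using (CStarRing.norm_of_mem_unitary hU).le

theorem continuous_conjDiag (d : n → ℝ) : Continuous fun U : Matrix n n ℂ => conjDiag U d := by
  unfold conjDiag
  fun_prop


/-- Uniform lower bound for the images of the coordinate projections of rank `|S|` in all orthonormal
bases. Near a given `U` the subspace belonging to `U` still works with half its constant, and
finitely many such neighbourhoods cover the unitary group. -/
theorem exists_uniform_pos (hT : IsPositive T) (hR : RankNonDecreasing T) (S : Finset (Fin N)) :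
    ∃ ε : ℝ, 0 < ε ∧ ∀ U ∈ unitaryGroup (Fin N) ℂ, ∃ V : Submodule ℂ (Fin N → ℂ),
      S.card ≤ Module.finrank ℂ V ∧ ∀ v ∈ V, ε * (star v ⬝ᵥ v).re ≤
        (star v ⬝ᵥ (T (conjDiag U fun i => if i ∈ S then 1 else 0) *ᵥ v)).re := by
  set E : M N → M N := fun U => conjDiag U fun i => if i ∈ S then 1 else 0 with hE
  have hEpos : ∀ U, (E U).PosSemidef := fun U =>
    posSemidef_conjDiag U fun i => by split_ifs <;> simp
  have hcont : Continuous fun U => T (E U) :=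
    (LinearMap.continuous_of_finiteDimensional T).comp (continuous_conjDiag _)
  refine isCompact_unitaryGroup.induction_on
    (p := fun s : Set (M N) => ∃ ε : ℝ, 0 < ε ∧ ∀ U ∈ s, ∃ V : Submodule ℂ (Fin N → ℂ),
      S.card ≤ Module.finrank ℂ V ∧ ∀ v ∈ V, ε * (star v ⬝ᵥ v).re ≤
        (star v ⬝ᵥ (T (E U) *ᵥ v)).re) ?_ ?_ ?_ ?_
  · exact ⟨1, one_pos, by simp⟩
  · rintro s t hst ⟨ε, hε, h⟩
    exact ⟨ε, hε, fun U hU => h U (hst hU)⟩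
  · rintro s t ⟨ε, hε, h⟩ ⟨δ, hδ, h'⟩
    refine ⟨min ε δ, lt_min hε hδ, fun U hU => ?_⟩
    have hnn : ∀ v : Fin N → ℂ, 0 ≤ (star v ⬝ᵥ v).re := fun v =>
      (Complex.le_def.1 (dotProduct_star_self_nonneg v)).1
    rcases hU with hU | hU
    · obtain ⟨V, hV, hv⟩ := h U hU
      exact ⟨V, hV, fun v hvV => (mul_le_mul_of_nonneg_right (min_le_left _ _) (hnn v)).trans
        (hv v hvV)⟩
    · obtain ⟨V, hV, hv⟩ := h' U hU
      exact ⟨V, hV, fun v hvV => (mul_le_mul_of_nonneg_right (min_le_right _ _) (hnn v)).trans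
        (hv v hvV)⟩
  · intro U₀ hU₀
    obtain ⟨ε, hε, V, hVr, hV⟩ := exists_submodule_rank_le_of_posSemidef (hT _ (hEpos U₀))
    have hcard : S.card ≤ Module.finrank ℂ V := by
      refine le_trans ?_ ((hR _ (hEpos U₀)).trans hVr)
      rw [hE, rank_conjDiag hU₀]
      exact Finset.card_le_card fun i hi => by simpa using hi
    refine ⟨{U | ‖T (E U) - T (E U₀)‖ < ε / 2}, mem_nhdsWithin_of_mem_nhds ?_, ε / 2, half_pos hε,
      fun U hU => ⟨V, hcard, fun v hv => ?_⟩⟩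
    · have : Continuous fun U => ‖T (E U) - T (E U₀)‖ := (hcont.sub continuous_const).norm
      refine (isOpen_lt this continuous_const).mem_nhds ?_
      simpa using hε
    · have h1 := hV v hv
      have h2 := neg_norm_mul_le_dotProduct_mulVec ((hT _ (hEpos U)).1.sub (hT _ (hEpos U₀)).1) v
      have h3 : 0 ≤ (star v ⬝ᵥ v).re := (Complex.le_def.1 (dotProduct_star_self_nonneg v)).1
      rw [sub_mulVec, dotProduct_sub, Complex.sub_re] at h2
      have h4 : ‖T (E U) - T (E U₀)‖ * (star v ⬝ᵥ v).re ≤ ε / 2 * (star v ⬝ᵥ v).re :=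
        mul_le_mul_of_nonneg_right (le_of_lt hU) h3
      linarith

end


/-- Rank non-decreasing operators have positive capacity. -/
theorem exists_det_lower_bound (hT : IsPositive T) (hR : RankNonDecreasing T) :
    ∃ c : ℝ, 0 < c ∧ ∀ X : M N, X.PosSemidef → c * ‖X.det‖ ≤ ‖(T X).det‖ := by
  obtain ⟨ε, hε, hεV⟩ : ∃ ε : ℝ, 0 < ε ∧ ∀ (S : Finset (Fin N)), ∀ U ∈ unitaryGroup (Fin N) ℂ,
      ∃ V : Submodule ℂ (Fin N → ℂ), S.card ≤ Module.finrank ℂ V ∧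
        ∀ v ∈ V, ε * (star v ⬝ᵥ v).re ≤
          (star v ⬝ᵥ (T (conjDiag U fun i => if i ∈ S then 1 else 0) *ᵥ v)).re := by
    choose e he heV using exists_uniform_pos hT hR
    refine ⟨Finset.univ.inf' Finset.univ_nonempty e, by simpa using he, fun S U hU => ?_⟩
    obtain ⟨V, hV, hv⟩ := heV S U hU
    refine ⟨V, hV, fun v hvV => le_trans ?_ (hv v hvV)⟩
    exact mul_le_mul_of_nonneg_right (Finset.inf'_le _ (Finset.mem_univ S))
      (Complex.le_def.1 (dotProduct_star_self_nonneg v)).1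
  refine ⟨ε ^ N, by positivity, fun X hX => ?_⟩
  obtain ⟨W, hW, μ, hμ, hTX⟩ := exists_eq_conjDiag_of_posSemidef (hT X hX)
  obtain ⟨U, hU, d, hd, rfl⟩ := exists_eq_conjDiag_of_posSemidef hX
  have hcount : ∀ i, (Finset.univ.filter fun k => d i ≤ d k).card ≤
      (Finset.univ.filter fun k => ε * d i ≤ μ k).card := by
    intro i
    set S := Finset.univ.filter fun k => d i ≤ d k with hS
    obtain ⟨V, hV, hv⟩ := hεV S U hU
    refine hV.trans (finrank_le_card_le_eigenvalues hW μ _ V fun v hvV => ?_)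
    have h1 : (conjDiag U d - (d i : ℂ) •
        conjDiag U (fun k => if k ∈ S then 1 else 0)).PosSemidef := by
      rw [← conjDiag_smul, ← conjDiag_sub]
      refine posSemidef_conjDiag U fun k => ?_
      by_cases hk : d i ≤ d k <;> simp [hS, hk, hd k]
    have h2 := (hT _ h1).re_dotProduct_nonneg v
    rw [map_sub, map_smul, sub_mulVec, dotProduct_sub, smul_mulVec, dotProduct_smul] at h2
    simp only [RCLike.re_to_complex, Complex.sub_re, smul_eq_mul, Complex.re_ofReal_mul] at h2
    rw [← hTX]
    nlinarith [mul_le_mul_of_nonneg_left (hv v hvV) (hd i)]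
  -- the counting inequality is Hall's condition: order the members of `s` by `d`
  obtain ⟨f, hf, hfμ⟩ := (Finset.all_card_le_biUnion_card_iff_exists_injective
    fun i => Finset.univ.filter fun k => ε * d i ≤ μ k).1 fun s => by
      rcases s.eq_empty_or_nonempty with rfl | hs
      · simp
      obtain ⟨i, his, hi⟩ := s.exists_min_image d hs
      calc s.card ≤ (Finset.univ.filter fun k => d i ≤ d k).card :=
            Finset.card_le_card fun k hk => by simpa using hi k hk
        _ ≤ _ := hcount i
        _ ≤ _ := Finset.card_le_card (Finset.subset_biUnion_of_mem
            (fun i => Finset.univ.filter fun k => ε * d i ≤ μ k) his)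
  rw [hTX, norm_det_conjDiag hU hd, norm_det_conjDiag hW hμ]
  calc ε ^ N * ∏ i, d i = ∏ i, ε * d i := by simp [Finset.prod_mul_distrib]
    _ ≤ ∏ i, μ (f i) := Finset.prod_le_prod (fun i _ => mul_nonneg hε.le (hd i))
        fun i _ => by simpa using hfμ i
    _ = ∏ i, μ i := (Finite.injective_iff_bijective.1 hf).prod_comp μ

end

variable {N : ℕ} {T : M N →ₗ[ℂ] M N}

/-! ### Duality, positivity and scalings -/

/-- Over `ℂ`, a matrix with nonnegative quadratic form is automatically Hermitian. -/
theorem posSemidef_of_dotProduct_mulVec_nonneg [DecidableEq n] {A : Matrix n n ℂ}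
    (h : ∀ v, 0 ≤ star v ⬝ᵥ (A *ᵥ v)) : A.PosSemidef := by
  rw [← isPositive_toEuclideanLin_iff, LinearMap.isPositive_iff_complex]
  intro v
  have := h v.ofLp
  have e : inner ℂ (A.toEuclideanLin v) v = star (star v.ofLp ⬝ᵥ (A *ᵥ v.ofLp)) := by
    rw [EuclideanSpace.inner_eq_star_dotProduct, star_dotProduct, toLpLin_apply, star_star]
    exact dotProduct_comm _ _
  have h2 := Complex.le_def.1 this
  rw [e]
  simp only [Complex.zero_re, Complex.zero_im] at h2
  refine ⟨?_, by simpa using h2.1⟩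
  apply Complex.ext <;> simp [← h2.2]

theorem trace_vecMulVec_star_mul (v : n → ℂ) (A : Matrix n n ℂ) :
    (vecMulVec v (star v) * A).trace = star v ⬝ᵥ (A *ᵥ v) := by
  rw [vecMulVec_mul, trace_vecMulVec, dotProduct_mulVec, dotProduct_comm]

theorem IsPositive.dual (hT : IsPositive T) : IsPositive (dual T) := by
  intro Y hY
  rw [← posSemidef_conjTranspose_iff]
  refine posSemidef_of_dotProduct_mulVec_nonneg fun v => ?_
  rw [← trace_vecMulVec_star_mul, ← trace_dual]
  exact trace_mul_nonneg (hT _ (posSemidef_vecMulVec_self_star v)) hY.conjTranspose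

theorem dual_dual (T : M N →ₗ[ℂ] M N) : dual (dual T) = T := by
  ext1 Y
  refine (eq_dual (dual T) T (fun X Y => ?_) Y).symm
  have h := congrArg star (trace_dual T Y X)
  rw [← trace_conjTranspose, ← trace_conjTranspose, conjTranspose_mul, conjTranspose_mul,
    conjTranspose_conjTranspose, conjTranspose_conjTranspose] at h
  exact h.symm

theorem scaling_apply (C₁ C₂ : M N) (T : M N →ₗ[ℂ] M N) (X : M N) :
    scaling C₁ C₂ T X = C₁ * T (C₂ᴴ * X * C₂) * C₁ᴴ := rfl

theorem dual_scaling (C₁ C₂ : M N) (T : M N →ₗ[ℂ] M N) :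
    dual (scaling C₁ C₂ T) = scaling C₂ C₁ (dual T) := by
  ext1 Y
  refine (eq_dual (scaling C₁ C₂ T) (scaling C₂ C₁ (dual T)) (fun X Y => ?_) Y).symm
  calc (scaling C₁ C₂ T X * Yᴴ).trace
      = (C₁ * (T (C₂ᴴ * X * C₂) * (C₁ᴴ * Yᴴ))).trace := by
        rw [scaling_apply]; simp only [Matrix.mul_assoc]
    _ = (T (C₂ᴴ * X * C₂) * (C₁ᴴ * Y * C₁)ᴴ).trace := by
        rw [trace_mul_comm]
        simp only [conjTranspose_mul, conjTranspose_conjTranspose, Matrix.mul_assoc]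
    _ = (C₂ᴴ * (X * (C₂ * (dual T (C₁ᴴ * Y * C₁))ᴴ))).trace := by
        rw [trace_dual]; simp only [Matrix.mul_assoc]
    _ = (X * (scaling C₂ C₁ (dual T) Y)ᴴ).trace := by
        rw [trace_mul_comm, scaling_apply]
        simp only [conjTranspose_mul, conjTranspose_conjTranspose, Matrix.mul_assoc]

theorem scaling_scaling (C₁ C₂ D₁ D₂ : M N) (T : M N →ₗ[ℂ] M N) :
    scaling D₁ D₂ (scaling C₁ C₂ T) = scaling (D₁ * C₁) (D₂ * C₂) T := by
  ext1 X
  simp only [scaling_apply, conjTranspose_mul, Matrix.mul_assoc]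

theorem scaling_one_one (T : M N →ₗ[ℂ] M N) : scaling 1 1 T = T := by
  ext1 X
  simp [scaling_apply]

theorem IsPositive.scaling (hT : IsPositive T) (C₁ C₂ : M N) : IsPositive (scaling C₁ C₂ T) :=
  fun _ hX => (hT _ (hX.conjTranspose_mul_mul_same C₂)).mul_mul_conjTranspose_same C₁

theorem IsPositive.posDef_one (hT : IsPositive T) (h : IsUnit (T 1)) : (T 1).PosDef :=
  (hT 1 PosSemidef.one).posDef_iff_isUnit.2 h

/-- If `X ≥ ε • 1`, then `T X ≥ ε • T 1`. -/
theorem IsPositive.map_posDef (hT : IsPositive T) (h : (T 1).PosDef) {X : M N} (hX : X.PosDef) :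
    (T X).PosDef := by
  obtain ⟨U, hU, d, hd, rfl⟩ := exists_eq_conjDiag_of_posDef hX
  obtain ⟨ε, hε, hεd⟩ := exists_pos_le_of_pos d
  have h1 : (conjDiag U d - (ε : ℂ) • 1).PosSemidef := by
    rw [← conjDiag_one hU, ← conjDiag_smul, ← conjDiag_sub]
    exact posSemidef_conjDiag U fun k => by simpa using hεd k (hd k)
  have h2 := hT _ h1
  rw [map_sub, map_smul] at h2
  have h3 : ((ε : ℂ) • T 1).PosDef := h.smul (by exact_mod_cast hε)
  simpa using PosDef.posSemidef_add h2 h3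

theorem eq_zero_of_rank_eq_zero {A : Matrix n n ℂ} (h : A.rank = 0) : A = 0 := by
  rw [rank, Submodule.finrank_eq_zero, LinearMap.range_eq_bot] at h
  exact mulVec_injective (funext fun v => by simpa using LinearMap.congr_fun h v)

/-- If `T*(I) v = 0` with `v ≠ 0`, then `tr (T (v vᴴ)) = vᴴ T*(I) v = 0`, so that `T` would annihilate
a matrix of rank one. -/
theorem RankNonDecreasing.scalable (hT : IsPositive T) (hR : RankNonDecreasing T) :
    Scalable T := by
  constructor
  · have h := hR 1 PosSemidef.one
    rw [rank_one, rank] at h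
    rw [← mulVec_surjective_iff_isUnit]
    change Function.Surjective (T 1).mulVecLin
    refine LinearMap.range_eq_top.1 (Submodule.eq_top_of_finrank_eq (le_antisymm ?_ ?_))
    · exact Submodule.finrank_le _
    · simpa using h
  · by_contra hu
    rw [isUnit_iff_isUnit_det, isUnit_iff_ne_zero, not_not, ← exists_mulVec_eq_zero_iff] at hu
    obtain ⟨v, hv, h0⟩ := hu
    have hpos := posSemidef_vecMulVec_self_star v
    have htr := trace_dual T (vecMulVec v (star v)) 1
    rw [(hT.dual 1 PosSemidef.one).1.eq, trace_vecMulVec_star_mul, h0, dotProduct_zero,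
      conjTranspose_one, Matrix.mul_one, (hT _ hpos).trace_eq_zero_iff] at htr
    have h := hR _ hpos
    rw [htr, rank_zero, Nat.le_zero] at h
    have := eq_zero_of_rank_eq_zero h
    simp [hv] at this

/-- No invertibility of `C₁` and `C₂` is assumed: that of `C₂` follows from `RankNonDecreasing.scalable`
for the scaling, and left multiplication by `C₁` can only lower ranks. -/
theorem RankNonDecreasing.of_scaling (hT : IsPositive T) {C₁ C₂ : M N}
    (hR : RankNonDecreasing (scaling C₁ C₂ T)) : RankNonDecreasing T := by
  have hu : IsUnit C₂.det := by
    have h := (hR.scalable (hT.scaling C₁ C₂)).2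
    rw [dual_scaling, scaling_apply, isUnit_iff_isUnit_det, det_mul, det_mul] at h
    exact isUnit_of_mul_isUnit_left (isUnit_of_mul_isUnit_left h)
  have hu' : IsUnit C₂ᴴ.det := by rw [det_conjTranspose]; exact hu.star
  intro X hX
  have h := hR _ (hX.mul_mul_conjTranspose_same C₂⁻¹ᴴ)
  rw [scaling_apply, conjTranspose_conjTranspose] at h
  have e : C₂ᴴ * (C₂⁻¹ᴴ * X * C₂⁻¹) * C₂ = X := by
    simp only [conjTranspose_nonsing_inv, Matrix.mul_assoc, nonsing_inv_mul _ hu, Matrix.mul_one]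
    rw [← Matrix.mul_assoc, mul_nonsing_inv _ hu', Matrix.one_mul]
  rw [e, rank_mul_eq_left_of_isUnit_det _ _ (isUnit_nonsing_inv_det _ hu), conjTranspose_nonsing_inv,
    rank_mul_eq_right_of_isUnit_det _ _ (isUnit_nonsing_inv_det _ hu')] at h
  exact h.trans ((rank_mul_le_left _ _).trans (rank_mul_le_right _ _))

theorem isUnit_invSqrt {A : M N} (hA : A.PosDef) : IsUnit (invSqrt A) := by
  have h := CFC.sqrt_mul_sqrt_self A hA.posSemidef.nonneg
  have h1 : IsUnit (CFC.sqrt A) := by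
    have := hA.isUnit
    rw [isUnit_iff_isUnit_det, ← h, det_mul] at this
    exact (isUnit_iff_isUnit_det _).2 (isUnit_of_mul_isUnit_left this)
  exact (isUnit_nonsing_inv_iff).2 h1

theorem isHermitian_invSqrt (A : M N) : (invSqrt A).IsHermitian :=
  (CFC.sqrt_nonneg A).posSemidef.isHermitian.inv

theorem invSqrt_mul_mul_invSqrt {A : M N} (hA : A.PosDef) : invSqrt A * A * invSqrt A = 1 := by
  have h := CFC.sqrt_mul_sqrt_self A hA.posSemidef.nonneg
  have h1 : IsUnit (CFC.sqrt A).det := by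
    have := (isUnit_iff_isUnit_det _).1 hA.isUnit
    rw [← h, det_mul] at this
    exact isUnit_of_mul_isUnit_left this
  conv_lhs => rw [invSqrt]; enter [1, 2]; rw [← h]
  rw [← Matrix.mul_assoc, nonsing_inv_mul _ h1, Matrix.one_mul, mul_nonsing_inv _ h1]

theorem rowScaling_one (hT : IsPositive T) (hS : Scalable T) : rowScaling T 1 = 1 := by
  have h := hT.posDef_one hS.1
  rw [rowScaling, scaling_apply, (isHermitian_invSqrt _).eq]
  simpa using invSqrt_mul_mul_invSqrt h

theorem scalable_dual (hS : Scalable T) : Scalable (dual T) :=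
  ⟨hS.2, by rw [dual_dual]; exact hS.1⟩

theorem scalable_rowScaling (hT : IsPositive T) (hS : Scalable T) : Scalable (rowScaling T) := by
  refine ⟨by rw [rowScaling_one hT hS]; exact isUnit_one, ?_⟩
  have h := hT.posDef_one hS.1
  rw [rowScaling, dual_scaling, scaling_apply, conjTranspose_one, Matrix.one_mul, Matrix.mul_one,
    Matrix.mul_one]
  refine (hT.dual.map_posDef (hT.dual.posDef_one hS.2) ?_).isUnit
  refine PosDef.conjTranspose_mul_self _ ?_
  exact mulVec_injective_of_isUnit (isUnit_invSqrt h)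

/-- Column scaling is row scaling of the dual, which reduces every statement on columns to rows. -/
theorem colScaling_eq (T : M N →ₗ[ℂ] M N) : colScaling T = dual (rowScaling (dual T)) := by
  rw [rowScaling, dual_scaling, dual_dual, colScaling]

theorem DS_dual (T : M N →ₗ[ℂ] M N) : DS (dual T) = DS T := by
  rw [DS, DS, dual_dual, add_comm]

theorem osi_add_one (T : M N →ₗ[ℂ] M N) (k : ℕ) :
    osi T (k + 1) = if Even k then rowScaling (osi T k) else colScaling (osi T k) := rfl

theorem exists_osi_eq_scaling (T : M N →ₗ[ℂ] M N) (k : ℕ) :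
    ∃ C₁ C₂ : M N, osi T k = scaling C₁ C₂ T := by
  induction k with
  | zero => exact ⟨1, 1, (scaling_one_one T).symm⟩
  | succ k ih =>
    obtain ⟨C₁, C₂, h⟩ := ih
    rw [osi_add_one]
    split_ifs
    · exact ⟨_, _, by rw [rowScaling, h, scaling_scaling]⟩
    · exact ⟨_, _, by rw [colScaling, h, scaling_scaling]⟩

theorem IsPositive.osi (hT : IsPositive T) (k : ℕ) : IsPositive (osi T k) := by
  obtain ⟨C₁, C₂, h⟩ := exists_osi_eq_scaling T k
  exact h ▸ hT.scaling C₁ C₂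

theorem scalable_osi (hT : IsPositive T) (hS : Scalable T) (k : ℕ) : Scalable (osi T k) := by
  induction k with
  | zero => exact hS
  | succ k ih =>
    rw [osi_add_one]
    split_ifs
    · exact scalable_rowScaling (hT.osi k) ih
    · rw [colScaling_eq]
      exact scalable_dual (scalable_rowScaling (hT.osi k).dual (scalable_dual ih))

/-! ### Operators close to doubly stochastic ones -/

theorem rankNonDecreasing_of_DS_lt (hT : IsPositive T) (hDS : DS T < 1 / (2 * N + 1)) :
    RankNonDecreasing T := by
  intro X hX
  by_contra! hlt
  obtain ⟨W, hW, e, he, hTX⟩ := exists_eq_conjDiag_of_posSemidef (hT X hX)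
  obtain ⟨U, hU, d, hd, rfl⟩ := exists_eq_conjDiag_of_posSemidef hX
  rw [hTX, rank_conjDiag hW, rank_conjDiag hU] at hlt
  obtain ⟨ε, hε, hεd⟩ := exists_pos_le_of_pos d
  -- `P` and `Q` are the orthogonal projections onto the ranges of `X` and `T X`
  set p : Fin N → ℝ := fun k => if d k ≠ 0 then 1 else 0 with hp
  set q : Fin N → ℝ := fun k => if e k ≠ 0 then 1 else 0 with hq
  set P := conjDiag U p with hP
  set Q := conjDiag W q with hQ
  have hp1 : ∀ k, 0 ≤ p k := fun k => by simp only [hp]; split_ifs <;> simp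
  have hq1 : ∀ k, 0 ≤ q k := fun k => by simp only [hq]; split_ifs <;> simp
  have hPt : P.trace.re = (Finset.univ.filter fun k => d k ≠ 0).card := by
    rw [hP, trace_conjDiag hU, Complex.ofReal_re, hp, Finset.sum_boole]
  have hQt : Q.trace.re = (Finset.univ.filter fun k => e k ≠ 0).card := by
    rw [hQ, trace_conjDiag hW, Complex.ofReal_re, hq, Finset.sum_boole]
  have hP2 : P ^ 2 = P := by
    rw [sq, hP, conjDiag_mul hU]; congr 1; ext k; simp only [hp]; split_ifs <;> simp
  have hQ2 : Q ^ 2 = Q := by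
    rw [sq, hQ, conjDiag_mul hW]; congr 1; ext k; simp only [hq]; split_ifs <;> simp
  have hPpos : P.PosSemidef := posSemidef_conjDiag U hp1
  have hQpos : Q.PosSemidef := posSemidef_conjDiag W hq1
  have hQ' : (1 - Q).PosSemidef := by
    rw [← conjDiag_one hW, hQ, ← conjDiag_sub]
    exact posSemidef_conjDiag W fun k => by simp only [hq]; split_ifs <;> simp
  have hP' : (1 - P).PosSemidef := by
    rw [← conjDiag_one hU, hP, ← conjDiag_sub]
    exact posSemidef_conjDiag U fun k => by simp only [hp]; split_ifs <;> simp
  -- `ε P ≤ X`, and `T X` vanishes on the range of `1 - Q`, hence so does `T P`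
  have h1 : (T P * (1 - Q)).trace.re ≤ 0 := by
    have hXP : (conjDiag U d - (ε : ℂ) • P).PosSemidef := by
      rw [hP, ← conjDiag_smul, ← conjDiag_sub]
      refine posSemidef_conjDiag U fun k => ?_
      by_cases hk : d k = 0
      · simp [hp, hk]
      · simpa [hp, hk] using hεd k ((hd k).lt_of_ne' hk)
    have h := trace_mul_nonneg (hT _ hXP) hQ'
    have h0 : T (conjDiag U d) * (1 - Q) = 0 := by
      rw [hTX, ← conjDiag_one hW, hQ, ← conjDiag_sub, conjDiag_mul hW]
      have : (fun i => e i * (1 - q i)) = fun i => 0 * (1 : ℝ) := by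
        ext k; by_cases hk : e k = 0 <;> simp [hq, hk]
      rw [this, conjDiag_smul]
      simp
    rw [map_sub, map_smul, sub_mul, h0, zero_sub, trace_neg, Matrix.smul_mul, trace_smul] at h
    have h2 := (Complex.le_def.1 h).1
    simp only [Complex.zero_re, smul_eq_mul, Complex.neg_re, Complex.re_ofReal_mul] at h2
    nlinarith
  have h2 : 0 ≤ ((T 1 - T P) * Q).trace.re := by
    rw [← map_sub]
    exact (Complex.le_def.1 (trace_mul_nonneg (hT _ hP') hQpos)).1
  have h3 : (T P).trace = (P * dual T 1).trace := by
    have := trace_dual T P 1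
    rwa [conjTranspose_one, Matrix.mul_one, (hT.dual 1 PosSemidef.one).1.eq] at this
  have hA := (hT 1 PosSemidef.one).1.sub (isHermitian_one (α := ℂ) (n := Fin N))
  have hB := (hT.dual 1 PosSemidef.one).1.sub (isHermitian_one (α := ℂ) (n := Fin N))
  -- the estimates `h4` and `h5` will add up to `2 * t ≤ DS T + 2 * N * t ^ 2`, and this value of
  -- `t` satisfies `2 * N * t ^ 2 ≤ t`
  set t : ℝ := 1 / (2 * N + 1) with ht
  have h4 := two_mul_trace_mul_le hA hQpos.1 t
  have h5 := two_mul_trace_mul_le hB hPpos.1 (-t)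
  rw [hQ2, hQt, sub_mul, Matrix.one_mul, trace_sub, Complex.sub_re, hQt] at h4
  rw [hP2, hPt, sub_mul, Matrix.one_mul, trace_sub, Complex.sub_re, hPt, trace_mul_comm, ← h3] at h5
  rw [mul_sub, Matrix.mul_one, trace_sub, Complex.sub_re] at h1
  rw [sub_mul, trace_sub, Complex.sub_re] at h2
  rw [DS, Complex.add_re] at hDS
  have c1 : ((Finset.univ.filter fun k => d k ≠ 0).card : ℝ) ≤ N := by
    exact_mod_cast (Finset.card_le_univ _).trans (by simp)
  have c2 : ((Finset.univ.filter fun k => e k ≠ 0).card : ℝ) + 1 ≤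
      (Finset.univ.filter fun k => d k ≠ 0).card := by exact_mod_cast hlt
  generalize ((Finset.univ.filter fun k => d k ≠ 0).card : ℝ) = r at *
  generalize ((Finset.univ.filter fun k => e k ≠ 0).card : ℝ) = s at *
  have ht0 : 0 < t := by positivity
  have ht1 : t * (2 * N + 1) = 1 := by rw [ht]; field_simp
  have c3 : t ^ 2 * (s + r) ≤ t ^ 2 * (2 * N) := by gcongr; linarith
  have c4 : t ^ 2 * (2 * N) ≤ t := by nlinarith
  have c5 : 2 * t * ((T P).trace.re - r) ≤ 2 * t * ((T 1 * Q).trace.re - s - 1) := by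
    
    exact mul_le_mul_of_nonneg_left (by linarith) (by positivity)
  linarith

/-! ### Convergence of the iteration -/

theorem DS_nonneg (hT : IsPositive T) : 0 ≤ DS T := by
  rw [DS, Complex.add_re]
  exact add_nonneg (trace_sq_nonneg ((hT 1 PosSemidef.one).1.sub isHermitian_one))
    (trace_sq_nonneg ((hT.dual 1 PosSemidef.one).1.sub isHermitian_one))

theorem DS_le_of_map_one (hT : IsPositive T) (hS : Scalable T) (h1 : T 1 = 1) :
    DS T ≤ (2 * N + 2) * (-Real.log ‖(dual T 1).det‖) := by
  have htr : (dual T 1).trace = Fintype.card (Fin N) := by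
    have h := trace_dual T 1 1
    rw [(hT.dual 1 PosSemidef.one).1.eq, h1] at h
    simpa using h.symm
  simpa [DS, h1] using trace_sub_one_sq_le (hT.dual.posDef_one hS.2) htr

theorem DS_le_of_dual_map_one (hT : IsPositive T) (hS : Scalable T) (h1 : dual T 1 = 1) :
    DS T ≤ (2 * N + 2) * (-Real.log ‖(T 1).det‖) := by
  simpa [DS_dual, dual_dual] using DS_le_of_map_one hT.dual (scalable_dual hS) h1

/-- The determinant of the matrix `T_k(I)` or `T_k*(I)` that step `k` of the iteration normalizes to
`1`. Lower bounds for the ratio `det (T_k X) / det X` are divided by it in that step. -/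
noncomputable def stepDet (T : M N →ₗ[ℂ] M N) (k : ℕ) : ℝ :=
  if Even k then ‖(osi T k 1).det‖ else ‖(dual (osi T k) 1).det‖

theorem stepDet_pos (hT : IsPositive T) (hS : Scalable T) (k : ℕ) : 0 < stepDet T k := by
  have h := scalable_osi hT hS k
  rw [stepDet]
  split_ifs
  · exact norm_pos_iff.2 ((isUnit_iff_isUnit_det _).1 h.1).ne_zero
  · exact norm_pos_iff.2 ((isUnit_iff_isUnit_det _).1 h.2).ne_zero

theorem osi_one_eq_one (hT : IsPositive T) (hS : Scalable T) {k : ℕ} (hk : Even k) :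
    osi T (k + 1) 1 = 1 := by
  rw [osi_add_one, if_pos hk]
  exact rowScaling_one (hT.osi k) (scalable_osi hT hS k)

theorem dual_osi_one_eq_one (hT : IsPositive T) (hS : Scalable T) {k : ℕ} (hk : ¬ Even k) :
    dual (osi T (k + 1)) 1 = 1 := by
  rw [osi_add_one, if_neg hk, colScaling_eq, dual_dual]
  exact rowScaling_one (hT.osi k).dual (scalable_dual (scalable_osi hT hS k))

theorem DS_osi_le (hT : IsPositive T) (hS : Scalable T) (k : ℕ) :
    DS (osi T (k + 1)) ≤ (2 * N + 2) * (-Real.log (stepDet T (k + 1))) := by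
  by_cases hk : Even k
  · rw [stepDet, if_neg (by simpa [Nat.even_add_one] using hk)]
    exact DS_le_of_map_one (hT.osi _) (scalable_osi hT hS _) (osi_one_eq_one hT hS hk)
  · rw [stepDet, if_pos (by simpa [Nat.even_add_one] using hk)]
    exact DS_le_of_dual_map_one (hT.osi _) (scalable_osi hT hS _) (dual_osi_one_eq_one hT hS hk)

theorem neg_log_stepDet_nonneg (hT : IsPositive T) (hS : Scalable T) (k : ℕ) :
    0 ≤ -Real.log (stepDet T (k + 1)) := by
  have := (DS_nonneg (hT.osi (k + 1))).trans (DS_osi_le hT hS k)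
  exact nonneg_of_mul_nonneg_right this (by positivity)

theorem norm_det_osi_one_le_one (hT : IsPositive T) (hS : Scalable T) (k : ℕ) :
    ‖(osi T (k + 1) 1).det‖ ≤ 1 := by
  by_cases hk : Even k
  · simp [osi_one_eq_one hT hS hk]
  · have h1 := neg_log_stepDet_nonneg hT hS k
    have h2 := stepDet_pos hT hS (k + 1)
    have h3 : stepDet T (k + 1) = ‖(osi T (k + 1) 1).det‖ :=
      if_pos (by simpa [Nat.even_add_one] using hk)
    rw [← h3]
    exact (Real.log_nonpos_iff h2.le).1 (by linarith)

theorem det_bound_scaling {c : ℝ} (h : ∀ X : M N, X.PosSemidef → c * ‖X.det‖ ≤ ‖(T X).det‖)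
    (C₁ C₂ X : M N) (hX : X.PosSemidef) :
    c * (‖C₁.det‖ ^ 2 * ‖C₂.det‖ ^ 2) * ‖X.det‖ ≤ ‖(scaling C₁ C₂ T X).det‖ := by
  have := h _ (hX.conjTranspose_mul_mul_same C₂)
  rw [scaling_apply]
  simp only [det_mul, det_conjTranspose, norm_mul, norm_star] at this ⊢
  calc _ = ‖C₁.det‖ ^ 2 * (c * (‖C₂.det‖ * ‖X.det‖ * ‖C₂.det‖)) := by ring
    _ ≤ ‖C₁.det‖ ^ 2 * ‖(T (C₂ᴴ * X * C₂)).det‖ := by gcongr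
    _ = _ := by ring

theorem norm_det_invSqrt_sq {A : M N} (hA : A.PosDef) : ‖(invSqrt A).det‖ ^ 2 = ‖A.det‖⁻¹ := by
  have h := congrArg (fun B : M N => ‖B.det‖) (invSqrt_mul_mul_invSqrt hA)
  simp only [det_mul, norm_mul, det_one, norm_one] at h
  exact eq_inv_of_mul_eq_one_left (by linarith)

theorem det_bound_osi (hT : IsPositive T) (hS : Scalable T) {c : ℝ}
    (h : ∀ X : M N, X.PosSemidef → c * ‖X.det‖ ≤ ‖(T X).det‖) (k : ℕ) :
    ∀ X : M N, X.PosSemidef →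
      c * (∏ j ∈ Finset.range k, (stepDet T j)⁻¹) * ‖X.det‖ ≤ ‖(osi T k X).det‖ := by
  induction k with
  | zero => simpa [osi] using h
  | succ k ih =>
    intro X hX
    have hS' := scalable_osi hT hS k
    rw [osi_add_one, Finset.prod_range_succ, ← mul_assoc]
    split_ifs with hk
    · have := det_bound_scaling ih (invSqrt (osi T k 1)) 1 X hX
      rw [norm_det_invSqrt_sq ((hT.osi k).posDef_one hS'.1)] at this
      simpa [stepDet, if_pos hk, rowScaling] using this
    · have := det_bound_scaling ih 1 (invSqrt (dual (osi T k) 1)) X hX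
      rw [norm_det_invSqrt_sq ((hT.osi k).dual.posDef_one hS'.2)] at this
      simpa [stepDet, if_neg hk, colScaling] using this

theorem tendsto_DS_osi (hT : IsPositive T) (hR : RankNonDecreasing T) :
    Tendsto (fun k => DS (osi T k)) atTop (𝓝 0) := by
  have hS := hR.scalable hT
  obtain ⟨c, hc, hcT⟩ := exists_det_lower_bound hT hR
  have hsum : ∀ k, ∑ j ∈ Finset.range k, -Real.log (stepDet T (j + 1)) ≤
      -Real.log c + Real.log (stepDet T 0) := by
    intro k
    have h1 := (det_bound_osi hT hS hcT (k + 1) 1 PosSemidef.one).trans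
      (norm_det_osi_one_le_one hT hS k)
    rw [det_one, norm_one, mul_one] at h1
    have hp : ∀ j, 0 < (stepDet T j)⁻¹ := fun j => inv_pos.2 (stepDet_pos hT hS j)
    have h2 := Real.log_nonpos (mul_nonneg hc.le (Finset.prod_nonneg fun j _ => (hp j).le)) h1
    rw [Real.log_mul hc.ne' (Finset.prod_pos fun j _ => hp j).ne',
      Real.log_prod fun j _ => (hp j).ne', Finset.sum_range_succ'] at h2
    simp only [Real.log_inv] at h2
    linarith
  have hlim : Tendsto (fun j => -Real.log (stepDet T (j + 1))) atTop (𝓝 0) :=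
    (summable_of_sum_range_le (neg_log_stepDet_nonneg hT hS) hsum).tendsto_atTop_zero
  -- `T_0` itself need not have a marginal equal to the identity, so the estimate starts at `T_1`
  rw [← tendsto_add_atTop_iff_nat 1]
  refine squeeze_zero (fun k => DS_nonneg (hT.osi _)) (DS_osi_le hT hS) ?_
  simpa using hlim.const_mul (2 * N + 2 : ℝ)

theorem rankNonDecreasing_of_DS_scaling_lt (hT : IsPositive T) {C₁ C₂ : M N}
    (h : DS (scaling C₁ C₂ T) < 1 / (2 * N + 1)) : RankNonDecreasing T :=
  (rankNonDecreasing_of_DS_lt (hT.scaling C₁ C₂) h).of_scaling hT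

theorem rankNonDecreasing_of_tendsto (hT : IsPositive T)
    (h : Tendsto (fun k => DS (osi T k)) atTop (𝓝 0)) : RankNonDecreasing T := by
  obtain ⟨k, hk⟩ := (h.eventually (gt_mem_nhds (show (0 : ℝ) < 1 / (2 * N + 1) by positivity))).exists
  obtain ⟨C₁, C₂, hC⟩ := exists_osi_eq_scaling T k
  exact rankNonDecreasing_of_DS_scaling_lt hT (hC ▸ hk)

end OpScaling

theorem theorem3p6 (N : ℕ) (T : OpScaling.M N →ₗ[ℂ] OpScaling.M N)
    (hT : OpScaling.IsPositive T) :
    -- the trajectory is well defined as soon as its first step is,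
    -- and then `DS (T_n) → 0` iff `T` is rank non-decreasing
    (OpScaling.Scalable T →
      (∀ n : ℕ, OpScaling.Scalable (OpScaling.osi T n)) ∧
      (Filter.Tendsto (fun n : ℕ => OpScaling.DS (OpScaling.osi T n)) Filter.atTop (nhds 0) ↔
        OpScaling.RankNonDecreasing T)) ∧
    -- a rank non-decreasing `T` always has a well-defined trajectory
    (OpScaling.RankNonDecreasing T → OpScaling.Scalable T) ∧
    -- the characterization by `ε`-doubly stochastic operator scalings
    (OpScaling.RankNonDecreasing T ↔
      ∀ ε : ℝ, 0 < ε → ∃ C₁ C₂ : OpScaling.M N,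
        OpScaling.IsEpsDoublyStochastic ε (OpScaling.scaling C₁ C₂ T)) := by
  refine ⟨fun hS => ⟨OpScaling.scalable_osi hT hS, OpScaling.rankNonDecreasing_of_tendsto hT,
    OpScaling.tendsto_DS_osi hT⟩, fun hR => hR.scalable hT, fun hR ε hε => ?_, fun h => ?_⟩
  · obtain ⟨k, hk⟩ := ((OpScaling.tendsto_DS_osi hT hR).eventually
      (gt_mem_nhds (pow_pos hε 2))).exists
    obtain ⟨C₁, C₂, hC⟩ := OpScaling.exists_osi_eq_scaling T k
    exact ⟨C₁, C₂, hT.scaling C₁ C₂, hC ▸ hk.le⟩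
  · obtain ⟨C₁, C₂, -, hC⟩ := h (1 / (2 * N + 2)) (by positivity)
    refine OpScaling.rankNonDecreasing_of_DS_scaling_lt hT (hC.trans_lt ?_)
    have h0 : (0 : ℝ) ≤ N := N.cast_nonneg
    rw [div_pow, one_pow]
    exact one_div_lt_one_div_of_lt (by positivity) (by nlinarith)
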